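/- Let $n\in\mathbb N$, and let $LC=LC(\mathbb R^n)$ be the set of functions $f=e^{-\psi}:\mathbb R^n\to[0,\infty)$ with $\psi:\mathbb R^n\to\mathbb R\cup\{\infty\}$ convex such that $f$ is upper semicontinuous, integrable and non-degenerate (the set $\{f>0\}$ has nonempty interior), equipped with the $L_1$-norm. Let $\mathcal A$ be the group of non-singular affine maps of $\mathbb R^n$; for $A\in\mathcal A$ write $\det A$ for the determinant of its linear part and $(Af)(x)=f(Ax)$. Let $B_2^n$ be the closed Euclidean unit ball. A John function of $f\in LC$ is a function $t_0\,\mathbb 1_{A_0B_2^n}$, where $(t_0,A_0)\in\mathbb R\times\mathcal A$ maximizes $t\,|\det A|$ among all $(t,A)\in\mathbb R\times\mathcal A$ with $t\le\|f\|_\infty$ and $t\,\mathbb 1_{AB_2^n}\le f$. **Theorem.** Every $f\in LC$ has exactly one John function $J(f)$, one has $J(f)\in LC$, and the John operator $J:LC\to LC$, $f\mapsto J(f)$, is an affine covariant mapping. That is, 1. $J$ is continuous: if $f_m,f\in LC$ and $\|f_m-f\|_1\to0$, then $\|J(f_m)-J(f)\|_1\to0$; 2. $J(Af)=A(J(f))$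 for all $f\in LC$ and all $A\in\mathcal A$. -/

import Mathlib

open MeasureTheory Filter Topology
open scoped ENNReal

/-- Euclidean space `ℝⁿ`. -/
abbrev Eucl (n : ℕ) : Type := EuclideanSpace ℝ (Fin n)

/-- `f = e^{-ψ}` with `ψ : ℝⁿ → ℝ ∪ {∞}` convex. The extended-valued convex function is given by
its effective domain `D = {ψ < ∞}`, a convex set, and by its finite values on `D`;
outside `D` one has `ψ = ∞`, hence `f = 0`. -/
def IsLogConcave {n : ℕ} (f : Eucl n → ℝ) : Prop :=
  ∃ (D : Set (Eucl n)) (ψ : Eucl n → ℝ),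
    ConvexOn ℝ D ψ ∧ f = D.indicator (fun x => Real.exp (-ψ x))

/-- Log-concave, upper semicontinuous, integrable functions that are non-degenerate, i.e. whose
support has nonempty interior (so that `0 < ‖f‖₁ < ∞`). -/
structure IsLC {n : ℕ} (f : Eucl n → ℝ) : Prop where
  logConcave : IsLogConcave f
  upperSemicontinuous : UpperSemicontinuous f
  integrable : Integrable f volume
  nondegenerate : (interior (Function.support f)).Nonempty

/-- The class `LC(ℝⁿ)`. -/
def LC (n : ℕ) : Type := {f : Eucl n → ℝ // IsLC f}

/-- The group of non-singular affine transformations of `ℝⁿ`. -/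
abbrev NonsingAffine (n : ℕ) : Type := Eucl n ≃ᵃ[ℝ] Eucl n

theorem integrable_comp_affineEquiv {n : ℕ} {f : Eucl n → ℝ} (hf : Integrable f volume)
    (A : NonsingAffine n) : Integrable (fun x => f (A x)) volume := by
  have hA : ∀ x, A x = A.linear x + A 0 := by
    intro x
    have h := A.map_vadd 0 x
    simpa using h
  have h1 : Integrable (fun y => f (y + A 0)) volume := hf.comp_add_right (A 0)
  have hdet : LinearMap.det (A.linear : Eucl n →ₗ[ℝ] Eucl n) ≠ 0 :=
    (LinearEquiv.isUnit_det' A.linear).ne_zero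
  have hmap := Measure.map_linearMap_addHaar_eq_smul_addHaar
    (volume : Measure (Eucl n)) hdet
  have h2 : Integrable (fun y => f (y + A 0))
      (Measure.map (A.linear : Eucl n →ₗ[ℝ] Eucl n) volume) := by
    rw [hmap]
    exact h1.smul_measure ENNReal.ofReal_ne_top
  have h3 := h2.comp_measurable
    (LinearMap.continuous_of_finiteDimensional (A.linear : Eucl n →ₗ[ℝ] Eucl n)).measurable
  refine h3.congr (Eventually.of_forall fun x => ?_)
  simp [hA x]

theorem IsLC.comp_affineEquiv {n : ℕ} {f : Eucl n → ℝ} (hf : IsLC f) (A : NonsingAffine n) :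
    IsLC (fun x => f (A x)) := by
  have hc : Continuous A := A.toAffineMap.continuous_of_finiteDimensional
  have hc' : Continuous A.symm := A.symm.toAffineMap.continuous_of_finiteDimensional
  refine ⟨?_, ?_, integrable_comp_affineEquiv hf.integrable A, ?_⟩
  · obtain ⟨D, ψ, hψ, rfl⟩ := hf.logConcave
    exact ⟨A ⁻¹' D, ψ ∘ A, hψ.comp_affineMap A.toAffineMap, rfl⟩
  · exact hf.upperSemicontinuous.comp hc
  · obtain ⟨y, hy⟩ := hf.nondegenerate
    refine ⟨A.symm y, preimage_interior_subset_interior_preimage (t := Function.support f) hc ?_⟩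
    simpa using hy

/-- The action `(A f)(x) = f (A x)` of non-singular affine transformations on `LC(ℝⁿ)`. -/
noncomputable def LC.act {n : ℕ} (A : NonsingAffine n) (f : LC n) : LC n :=
  ⟨fun x => f.1 (A x), f.2.comp_affineEquiv A⟩

/-- Convergence `f_m → f` in the `L₁`-norm. -/
def TendstoL1 {n : ℕ} (f : ℕ → LC n) (g : LC n) : Prop :=
  Tendsto (fun m => eLpNorm ((f m).1 - g.1) 1 volume) atTop (𝓝 0)

/-- Affine covariant mappings `P : LC → LC`: continuous with respect to the `L₁`-norm, and
`P (A f) = A (P f)` for all non-singular affine transformations `A`. -/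
structure IsAffineCovariant {n : ℕ} (P : LC n → LC n) : Prop where
  continuous : ∀ (f : ℕ → LC n) (g : LC n),
    TendstoL1 f g → TendstoL1 (fun m => P (f m)) (P g)
  covariant : ∀ (A : NonsingAffine n) (f : LC n), P (LC.act A f) = LC.act A (P f)

/-- The ellipsoid `A B₂ⁿ`, the image of the closed Euclidean unit ball. -/
def ellipsoid {n : ℕ} (A : NonsingAffine n) : Set (Eucl n) :=
  A '' Metric.closedBall 0 1

/-- The function `t 𝟙_{A B₂ⁿ}`. -/
noncomputable def ellipsoidFunction {n : ℕ} (t : ℝ) (A : NonsingAffine n) : Eucl n → ℝ :=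
  (ellipsoid A).indicator (fun _ => t)

/-- `|det A|`, the absolute determinant of the linear part. -/
noncomputable def absDet {n : ℕ} (A : NonsingAffine n) : ℝ :=
  |LinearMap.det (A.linear : Eucl n →ₗ[ℝ] Eucl n)|

/-- The constraints `t ≤ ‖f‖_∞` and `t 𝟙_{A B₂ⁿ} ≤ f`. -/
def IsJohnFeasible {n : ℕ} (f : Eucl n → ℝ) (t : ℝ) (A : NonsingAffine n) : Prop :=
  ENNReal.ofReal t ≤ eLpNorm f ∞ volume ∧ ∀ x, ellipsoidFunction t A x ≤ f x

/-- `(t, A)` solves the problem of maximizing `t |det A|` subject to the constraints. -/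
def IsJohnSolution {n : ℕ} (f : Eucl n → ℝ) (t : ℝ) (A : NonsingAffine n) : Prop :=
  IsJohnFeasible f t A ∧
    ∀ (s : ℝ) (B : NonsingAffine n), IsJohnFeasible f s B → s * absDet B ≤ t * absDet A

/-- `g` is a John function of `f`: `g = t₀ 𝟙_{A₀ B₂ⁿ}` for a solution `(t₀, A₀)`. -/
def IsJohnFunction {n : ℕ} (f g : Eucl n → ℝ) : Prop :=
  ∃ (t₀ : ℝ) (A₀ : NonsingAffine n), IsJohnSolution f t₀ A₀ ∧ g = ellipsoidFunction t₀ A₀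

/-! A pair (t, A) is a height over an ellipsoid, and feasibility only says f ≥ t on that ellipsoid
(`IsLC.isJohnFeasible_iff`).

Uniqueness. Choose coordinates in which one maximizer lives on the unit ball and the other on an
ellipsoid with semiaxes l i. Log-concavity makes the averaged ellipsoid with height √(t₁t₂)
feasible, and the arithmetic-geometric mean inequality makes its value too large unless every l i =
1 (`IsJohnSolution.semiaxes_eq_one`). Distinct translates at equal height are impossible, since
their convex hull contains a larger ellipsoid (`IsJohnSolution.translation_eq_zero`).

Existence and continuity share one compactness argument. If f m → g in L₁, feasible pairs for f m
with value bounded below stay bounded (`TendstoL1.eventually_isJohnFeasible_bounds`): log-concavity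
converts a great height or a distant point into mass that is not available. The lower bound on the
value keeps limits non-singular, and limits are feasible for g (`TendstoL1.isJohnFeasible`). A
constant sequence gives existence. For continuity, shrinking the optimal pair of g slightly makes it
feasible for f m (`TendstoL1.eventually_value_le`), so subsequential limits of John pairs are
optimal for g, and uniqueness identifies them. Covariance is a change of variables followed by
uniqueness. -/

variable {n : ℕ}

/-! ### Affine maps and ellipsoids -/

namespace NonsingAffine

/-- The affine map `x ↦ L x + b`, for `L` with non-zero determinant. -/
noncomputable def mk' (L : Eucl n →ₗ[ℝ] Eucl n) (h : LinearMap.det L ≠ 0) (b : Eucl n) :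
    NonsingAffine n :=
  (LinearEquiv.ofIsUnitDet (v := Module.finBasis ℝ (Eucl n)) (v' := Module.finBasis ℝ (Eucl n))
    (f := L) (by rw [LinearMap.det_toMatrix]; exact h.isUnit)).toAffineEquiv.trans
    (AffineEquiv.constVAdd ℝ (Eucl n) b)

theorem mk'_apply (L : Eucl n →ₗ[ℝ] Eucl n) (h : LinearMap.det L ≠ 0) (b x : Eucl n) :
    mk' L h b x = L x + b := by
  simp [mk', add_comm]

theorem mk'_linear (L : Eucl n →ₗ[ℝ] Eucl n) (h : LinearMap.det L ≠ 0) (b : Eucl n) :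
    ((mk' L h b).linear : Eucl n →ₗ[ℝ] Eucl n) = L := by
  rfl

theorem absDet_mk' (L : Eucl n →ₗ[ℝ] Eucl n) (h : LinearMap.det L ≠ 0) (b : Eucl n) :
    absDet (mk' L h b) = |LinearMap.det L| := by
  rw [absDet, mk'_linear]

theorem apply_eq (A : NonsingAffine n) (x : Eucl n) : A x = A.linear x + A 0 := by
  simpa using A.map_vadd 0 x

theorem continuous (A : NonsingAffine n) : Continuous A :=
  A.toAffineMap.continuous_of_finiteDimensional

theorem isOpenMap (A : NonsingAffine n) : IsOpenMap A := fun s hs => by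
  have : A '' s = A.symm ⁻¹' s := A.toEquiv.image_eq_preimage_symm s
  rw [this]
  exact hs.preimage A.symm.toAffineMap.continuous_of_finiteDimensional

end NonsingAffine

theorem absDet_pos (A : NonsingAffine n) : 0 < absDet A :=
  abs_pos.2 (LinearEquiv.isUnit_det' A.linear).ne_zero

/-- `A.trans B` is `x ↦ B (A x)`. -/
theorem absDet_trans (A B : NonsingAffine n) : absDet (A.trans B) = absDet B * absDet A := by
  have : ((A.trans B).linear : Eucl n →ₗ[ℝ] Eucl n)
      = (B.linear : Eucl n →ₗ[ℝ] Eucl n) ∘ₗ (A.linear : Eucl n →ₗ[ℝ] Eucl n) := rfl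
  rw [absDet, absDet, absDet, this, LinearMap.det_comp, abs_mul]

theorem ellipsoid_trans (A B : NonsingAffine n) : ellipsoid (A.trans B) = B '' ellipsoid A := by
  simp [ellipsoid, Set.image_image]

theorem isCompact_ellipsoid (A : NonsingAffine n) : IsCompact (ellipsoid A) :=
  (isCompact_closedBall _ _).image A.continuous

theorem convex_ellipsoid (A : NonsingAffine n) : Convex ℝ (ellipsoid A) :=
  (convex_closedBall _ _).affine_image A.toAffineMap

theorem interior_ellipsoid (A : NonsingAffine n) :
    interior (ellipsoid A) = A '' Metric.ball 0 1 := by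
  refine Set.Subset.antisymm (fun x hx => ?_)
    (interior_maximal (Set.image_mono Metric.ball_subset_closedBall)
      (A.isOpenMap _ Metric.isOpen_ball))
  have h : A ⁻¹' interior (ellipsoid A) ⊆ interior (Metric.closedBall 0 1) :=
    interior_maximal ((Set.preimage_mono interior_subset).trans
      (Set.preimage_image_eq _ A.injective).subset) (isOpen_interior.preimage A.continuous)
  rw [interior_closedBall _ one_ne_zero] at h
  exact ⟨A.symm x, h (by simpa using hx), by simp⟩

theorem interior_ellipsoid_nonempty (A : NonsingAffine n) : (interior (ellipsoid A)).Nonempty :=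
  ⟨A 0, by rw [interior_ellipsoid]; exact ⟨0, by simp, rfl⟩⟩

theorem mem_ellipsoid_iff {A : NonsingAffine n} {x : Eucl n} : x ∈ ellipsoid A ↔ ‖A.symm x‖ ≤ 1 := by
  constructor
  · rintro ⟨y, hy, rfl⟩
    simpa using hy
  · exact fun h => ⟨A.symm x, by simpa using h, by simp⟩

/-- The volume of an ellipsoid. -/
theorem volume_real_ellipsoid (A : NonsingAffine n) :
    volume.real (ellipsoid A) = absDet A * volume.real (Metric.closedBall (0 : Eucl n) 1) := by
  have h : ellipsoid A = (fun x => x + A 0) ''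
      ((A.linear : Eucl n →ₗ[ℝ] Eucl n) '' Metric.closedBall (0 : Eucl n) 1) := by
    rw [ellipsoid, Set.image_image]
    exact Set.image_congr fun y _ => A.apply_eq y
  rw [h, measureReal_def, Set.image_add_right, measure_preimage_add_right,
    Measure.addHaar_image_linearMap, ENNReal.toReal_mul,
    ENNReal.toReal_ofReal (abs_nonneg _)]
  rfl

/-! ### Pointwise properties of log-concave functions -/

namespace IsLC

variable {f : Eucl n → ℝ}

theorem nonneg (hf : IsLC f) (x : Eucl n) : 0 ≤ f x := by
  obtain ⟨D, ψ, -, rfl⟩ := hf.logConcave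
  exact Set.indicator_nonneg (fun _ _ => (Real.exp_pos _).le) x

theorem measurable (hf : IsLC f) : Measurable f := hf.upperSemicontinuous.measurable

/-- The superlevel sets of a log-concave function are convex. -/
theorem convex_le (hf : IsLC f) (t : ℝ) : Convex ℝ {x | t ≤ f x} := by
  rcases le_or_gt t 0 with ht | ht
  · convert convex_univ
    exact Set.eq_univ_of_forall fun x => ht.trans (hf.nonneg x)
  obtain ⟨D, ψ, hψ, rfl⟩ := hf.logConcave
  convert hψ.convex_le (-Real.log t) using 1
  ext x
  simp only [Set.mem_ofPred_eq]
  by_cases hx : x ∈ D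
  · simp only [hx, Set.indicator_of_mem, true_and]
    rw [← Real.log_le_iff_le_exp ht, le_neg]
  · simp [hx, ht]

theorem mul_le_sq_midpoint (hf : IsLC f) (x y : Eucl n) : f x * f y ≤ f (midpoint ℝ x y) ^ 2 := by
  obtain ⟨D, ψ, hψ, rfl⟩ := hf.logConcave
  by_cases hx : x ∈ D
  · by_cases hy : y ∈ D
    · have hm : midpoint ℝ x y = (1 / 2 : ℝ) • x + (1 / 2 : ℝ) • y := by
        rw [midpoint_eq_smul_add, smul_add]; norm_num
      have h1 : midpoint ℝ x y ∈ D := hψ.1.midpoint_mem hx hy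
      have h2 := (convexOn_iff_forall_pos.1 hψ).2 hx hy (one_half_pos (α := ℝ)) one_half_pos (add_halves 1)
      rw [← hm] at h2
      simp only [hx, hy, h1, Set.indicator_of_mem]
      rw [← Real.exp_add, sq, ← Real.exp_add, Real.exp_le_exp]
      simp only [smul_eq_mul] at h2
      linarith
    · simp [hy, sq_nonneg]
  · simp [hx, sq_nonneg]

/-- Midpoint log-concavity, in terms of lower bounds. -/
theorem sqrt_mul_le_midpoint (hf : IsLC f) {x y : Eucl n} {s t : ℝ} (ht : 0 ≤ t)
    (hx : s ≤ f x) (hy : t ≤ f y) : √(s * t) ≤ f (midpoint ℝ x y) := by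
  rw [Real.sqrt_le_left (hf.nonneg _)]
  exact (mul_le_mul hx hy ht (hf.nonneg _)).trans (hf.mul_le_sq_midpoint x y)

/-- A function in `LC` is bounded below by a positive constant on some ball. -/
theorem exists_closedBall_le (hf : IsLC f) :
    ∃ (x₀ : Eucl n) (r a : ℝ), 0 < r ∧ 0 < a ∧ ∀ x ∈ Metric.closedBall x₀ r, a ≤ f x := by
  obtain ⟨x₀, hx₀⟩ := hf.nondegenerate
  obtain ⟨D, ψ, hψ, rfl⟩ := hf.logConcave
  have hs : Function.support (D.indicator fun x => Real.exp (-ψ x)) = D := by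
    ext x; simp [(Real.exp_pos _).ne']
  rw [hs] at hx₀
  obtain ⟨r, hr, hb⟩ := Metric.nhds_basis_closedBall.mem_iff.1 (isOpen_interior.mem_nhds hx₀)
  -- A convex function is continuous in the interior of its domain, hence bounded on compact balls
  -- there.
  obtain ⟨M, hM⟩ := (isCompact_closedBall x₀ r).bddAbove_image
    (hψ.continuousOn_interior.mono hb)
  refine ⟨x₀, r, Real.exp (-M), hr, Real.exp_pos _, fun x hx => ?_⟩
  rw [Set.indicator_of_mem (interior_subset (hb hx)), Real.exp_le_exp, neg_le_neg_iff]
  exact hM ⟨x, hx, rfl⟩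

/-- The constraint `t ≤ ‖f‖_∞` follows from `t 𝟙_{A B₂ⁿ} ≤ f`. -/
theorem isJohnFeasible_iff (hf : IsLC f) {t : ℝ} {A : NonsingAffine n} :
    IsJohnFeasible f t A ↔ ∀ x ∈ ellipsoid A, t ≤ f x := by
  constructor
  · intro h x hx
    simpa [ellipsoidFunction, hx] using h.2 x
  · intro h
    refine ⟨?_, fun x => ?_⟩
    · by_contra! hlt
      have h0 : volume {x | eLpNorm f ∞ volume < ‖f x‖ₑ} = 0 := by
        have h := ENNReal.ae_le_essSup (μ := volume) fun x => ‖f x‖ₑ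
        rw [ae_iff] at h
        simpa only [eLpNorm_exponent_top, eLpNormEssSup, not_le] using h
      -- Otherwise f exceeds its essential supremum on a nonempty open set, which has positive
      -- measure.
      have h1 : interior (ellipsoid A) ⊆ {x | eLpNorm f ∞ volume < ‖f x‖ₑ} := fun x hx => by
        refine hlt.trans_le ?_
        rw [Real.enorm_eq_ofReal (hf.nonneg x)]
        exact ENNReal.ofReal_le_ofReal (h x (interior_subset hx))
      exact (isOpen_interior.measure_pos volume (interior_ellipsoid_nonempty A)).ne'
        (measure_mono_null h1 h0)
    · exact Set.indicator_le' (fun x hx => h x hx) (fun x _ => hf.nonneg x) x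

end IsLC

/-! ### Principal axes of ellipsoids -/

/-- The linear map with matrix `diag l` in the orthonormal basis `u`. -/
noncomputable def diagMap (u : OrthonormalBasis (Fin n) ℝ (Eucl n)) (l : Fin n → ℝ) :
    Eucl n →ₗ[ℝ] Eucl n :=
  Matrix.toLin u.toBasis u.toBasis (Matrix.diagonal l)

theorem repr_diagMap (u : OrthonormalBasis (Fin n) ℝ (Eucl n)) (l : Fin n → ℝ) (x : Eucl n)
    (i : Fin n) : u.repr (diagMap u l x) i = l i * u.repr x i := by
  have h := congrFun (LinearMap.toMatrix_mulVec_repr u.toBasis u.toBasis (diagMap u l) x) i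
  rw [diagMap, LinearMap.toMatrix_toLin, Matrix.mulVec_diagonal] at h
  simpa [diagMap] using h.symm

theorem det_diagMap (u : OrthonormalBasis (Fin n) ℝ (Eucl n)) (l : Fin n → ℝ) :
    LinearMap.det (diagMap u l) = ∏ i, l i := by
  rw [diagMap, LinearMap.det_toLin, Matrix.det_diagonal]

/-- The affine map `x ↦ diag(l) x + b` with respect to the orthonormal basis `u`. -/
noncomputable def diagAffine (u : OrthonormalBasis (Fin n) ℝ (Eucl n)) (l : Fin n → ℝ)
    (hl : ∀ i, 0 < l i) (b : Eucl n) : NonsingAffine n :=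
  .mk' (diagMap u l) (by rw [det_diagMap]; exact (Finset.prod_pos fun i _ => hl i).ne') b

theorem diagAffine_apply (u : OrthonormalBasis (Fin n) ℝ (Eucl n)) (l : Fin n → ℝ)
    (hl : ∀ i, 0 < l i) (b x : Eucl n) : diagAffine u l hl b x = diagMap u l x + b :=
  NonsingAffine.mk'_apply _ _ _ _

theorem absDet_diagAffine (u : OrthonormalBasis (Fin n) ℝ (Eucl n)) (l : Fin n → ℝ)
    (hl : ∀ i, 0 < l i) (b : Eucl n) : absDet (diagAffine u l hl b) = ∏ i, l i := by
  rw [diagAffine, NonsingAffine.absDet_mk', det_diagMap,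
    abs_of_pos (Finset.prod_pos fun i _ => hl i)]

theorem norm_sq_eq_sum_repr (u : OrthonormalBasis (Fin n) ℝ (Eucl n)) (x : Eucl n) :
    ‖x‖ ^ 2 = ∑ i, u.repr x i ^ 2 := by
  rw [← u.repr.norm_map x, EuclideanSpace.real_norm_sq_eq]

/-- Every positive definite quadratic form `‖N x‖²` is diagonal in some orthonormal basis. -/
theorem exists_norm_sq_eq_sum (N : Eucl n ≃ₗ[ℝ] Eucl n) :
    ∃ (u : OrthonormalBasis (Fin n) ℝ (Eucl n)) (l : Fin n → ℝ), (∀ i, 0 < l i) ∧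
      ∀ x, ‖N x‖ ^ 2 = ∑ i, (u.repr x i / l i) ^ 2 := by
  let N' : Eucl n →ₗ[ℝ] Eucl n := N
  have hT : (N'.adjoint * N').IsSymmetric := N'.isSymmetric_adjoint_mul_self
  have hn : Module.finrank ℝ (Eucl n) = n := finrank_euclideanSpace_fin
  have key : ∀ x, ‖N x‖ ^ 2
      = ∑ i, hT.eigenvalues hn i * (hT.eigenvectorBasis hn).repr x i ^ 2 := fun x => by
    have h1 : inner ℝ x ((N'.adjoint * N') x) = ‖N x‖ ^ 2 := by
      rw [Module.End.mul_apply, LinearMap.adjoint_inner_right]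
      exact real_inner_self_eq_norm_sq _
    rw [← h1, ← (hT.eigenvectorBasis hn).repr.inner_map_map, PiLp.inner_apply]
    refine Finset.sum_congr rfl fun i _ => ?_
    rw [hT.eigenvectorBasis_apply_self_apply]
    simp only [RCLike.inner_apply, conj_trivial, RCLike.ofReal_real_eq_id, id]
    ring
  have hpos : ∀ i, 0 < hT.eigenvalues hn i := fun i => by
    have h := key (hT.eigenvectorBasis hn i)
    rw [Finset.sum_eq_single i] at h
    · rw [OrthonormalBasis.repr_self] at h
      simp only [PiLp.single_apply, if_true, one_pow, mul_one] at h
      rw [← h, sq_pos_iff, norm_ne_zero_iff]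
      exact (map_ne_zero_iff N N.injective).2 ((hT.eigenvectorBasis hn).orthonormal.ne_zero i)
    · intro j _ hj
      simp [OrthonormalBasis.repr_self, hj]
    · simp
  refine ⟨hT.eigenvectorBasis hn, fun i => (√(hT.eigenvalues hn i))⁻¹,
    fun i => inv_pos.2 (Real.sqrt_pos.2 (hpos i)), fun x => ?_⟩
  rw [key]
  refine Finset.sum_congr rfl fun i _ => ?_
  rw [div_inv_eq_mul, mul_pow, Real.sq_sqrt (hpos i).le, mul_comm]

/-- Every ellipsoid has a representation with a diagonal linear part. -/
theorem exists_ellipsoid_eq_diagAffine (C : NonsingAffine n) :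
    ∃ (u : OrthonormalBasis (Fin n) ℝ (Eucl n)) (l : Fin n → ℝ) (hl : ∀ i, 0 < l i) (b : Eucl n),
      ellipsoid C = ellipsoid (diagAffine u l hl b) := by
  obtain ⟨u, l, hl, h⟩ := exists_norm_sq_eq_sum C.linear.symm
  refine ⟨u, l, hl, C 0, ?_⟩
  -- The two parametrizations differ by a norm-preserving map, so they have the same image of the
  -- unit ball.
  have hz : ∀ z, ‖C.symm (diagAffine u l hl (C 0) z)‖ = ‖z‖ := fun z => by
    have h1 : C.symm (diagAffine u l hl (C 0) z) = C.linear.symm (diagMap u l z) := by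
      rw [AffineEquiv.symm_apply_eq, C.apply_eq (C.linear.symm _), LinearEquiv.apply_symm_apply,
        diagAffine_apply]
    rw [h1, ← sq_eq_sq₀ (norm_nonneg _) (norm_nonneg _), h, norm_sq_eq_sum_repr u]
    refine Finset.sum_congr rfl fun i _ => ?_
    rw [repr_diagMap, mul_div_cancel_left₀ _ (hl i).ne']
  ext y
  obtain ⟨z, rfl⟩ := (diagAffine u l hl (C 0)).surjective y
  rw [mem_ellipsoid_iff, mem_ellipsoid_iff, hz, AffineEquiv.symm_apply_apply]

/-- The volume of an ellipsoid determines the determinant, although not the parametrization. -/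
theorem absDet_eq_of_ellipsoid_eq {A B : NonsingAffine n} (h : ellipsoid A = ellipsoid B) :
    absDet A = absDet B := by
  have h1 := volume_real_ellipsoid A
  rw [h, volume_real_ellipsoid B] at h1
  refine (mul_right_cancel₀ (ENNReal.toReal_pos ?_ ?_).ne' h1).symm
  · exact (Metric.measure_closedBall_pos volume _ one_pos).ne'
  · exact measure_closedBall_lt_top.ne

/-! ### Uniqueness of the maximizer -/

theorem IsLC.exists_isJohnFeasible_pos {f : Eucl n → ℝ} (hf : IsLC f) :
    ∃ (t : ℝ) (A : NonsingAffine n), 0 < t ∧ IsJohnFeasible f t A := by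
  obtain ⟨x₀, r, a, hr, ha, h⟩ := hf.exists_closedBall_le
  have hdet : LinearMap.det (r • LinearMap.id : Eucl n →ₗ[ℝ] Eucl n) ≠ 0 := by
    rw [LinearMap.det_smul, LinearMap.det_id, mul_one]
    exact (pow_pos hr _).ne'
  refine ⟨a, .mk' _ hdet x₀, ha, hf.isJohnFeasible_iff.2 ?_⟩
  rintro _ ⟨z, hz, rfl⟩
  refine h _ ?_
  rw [NonsingAffine.mk'_apply, mem_closedBall_iff_norm]
  simp only [LinearMap.smul_apply, LinearMap.id_apply, add_sub_cancel_right, norm_smul,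
    Real.norm_of_nonneg hr.le]
  exact mul_le_of_le_one_right hr.le (by simpa using hz)

theorem IsJohnSolution.pos {f : Eucl n → ℝ} (hf : IsLC f) {t : ℝ} {A : NonsingAffine n}
    (h : IsJohnSolution f t A) : 0 < t := by
  obtain ⟨s, B, hs, hB⟩ := hf.exists_isJohnFeasible_pos
  exact pos_of_mul_pos_left ((mul_pos hs (absDet_pos B)).trans_le (h.2 s B hB)) (absDet_pos A).le

/-- Arithmetic-geometric mean inequality for 1 and `l i`, factor by factor, strict wherever `l i ≠
1`. -/
theorem prod_sqrt_lt_prod_half {l : Fin n → ℝ} (hl : ∀ i, 0 < l i) (h : ∃ i, l i ≠ 1) :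
    ∏ i, √(l i) < ∏ i, (1 + l i) / 2 := by
  have h1 : ∀ i, (1 + l i) / 2 - √(l i) = (√(l i) - 1) ^ 2 / 2 := fun i => by
    rw [sub_sq, Real.sq_sqrt (hl i).le]; ring
  obtain ⟨j, hj⟩ := h
  refine Finset.prod_lt_prod (fun i _ => Real.sqrt_pos.2 (hl i)) (fun i _ => ?_)
    ⟨j, Finset.mem_univ j, ?_⟩
  · have := h1 i; nlinarith [sq_nonneg (√(l i) - 1)]
  · have h2 : √(l j) - 1 ≠ 0 := fun h0 => hj (by
      rw [← Real.sq_sqrt (hl j).le, sub_eq_zero.1 h0, one_pow])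
    have := h1 j; have := sq_pos_of_ne_zero h2; linarith

/-- If one solution has semiaxes `l` relative to another one, then all `l i` are `1` and the
heights agree. -/
theorem IsJohnSolution.semiaxes_eq_one {f : Eucl n → ℝ} (hf : IsLC f) {t₁ t₂ : ℝ}
    {A : NonsingAffine n} {u : OrthonormalBasis (Fin n) ℝ (Eucl n)} {l : Fin n → ℝ}
    {hl : ∀ i, 0 < l i} {b : Eucl n} (h₁ : IsJohnSolution f t₁ A)
    (h₂ : IsJohnSolution f t₂ ((diagAffine u l hl b).trans A)) : (∀ i, l i = 1) ∧ t₁ = t₂ := by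
  have ht₁ := h₁.pos hf
  have ht₂ := h₂.pos hf
  have hA := absDet_pos A
  have hval : t₁ = t₂ * ∏ i, l i := by
    have h := le_antisymm (h₂.2 _ _ h₁.1) (h₁.2 _ _ h₂.1)
    rw [absDet_trans, absDet_diagAffine] at h
    exact mul_right_cancel₀ hA.ne' (by linear_combination h)
  have hl' : ∀ i, 0 < (1 + l i) / 2 := fun i => by have := hl i; positivity
  -- Each point of the averaged ellipsoid is the midpoint of corresponding points of the two given
  -- ones.
  have hfeas : IsJohnFeasible f √(t₁ * t₂)
      ((diagAffine u (fun i => (1 + l i) / 2) hl' ((1 / 2 : ℝ) • b)).trans A) := by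
    rw [hf.isJohnFeasible_iff]
    rintro _ ⟨z, hz, rfl⟩
    have hm : diagAffine u (fun i => (1 + l i) / 2) hl' ((1 / 2 : ℝ) • b) z
        = midpoint ℝ z (diagAffine u l hl b z) := by
      rw [diagAffine_apply, diagAffine_apply, midpoint_eq_smul_add]
      apply u.repr.injective
      ext i
      simp only [map_add, map_smul, PiLp.add_apply, PiLp.smul_apply, repr_diagMap, smul_eq_mul,
        invOf_eq_inv]
      ring
    rw [AffineEquiv.trans_apply, hm, AffineEquiv.map_midpoint]
    exact hf.sqrt_mul_le_midpoint ht₂.le (hf.isJohnFeasible_iff.1 h₁.1 _ ⟨z, hz, rfl⟩)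
      (hf.isJohnFeasible_iff.1 h₂.1 _ ⟨z, hz, rfl⟩)
  have hone : ∀ i, l i = 1 := by
    by_contra! hne
    have hlt := prod_sqrt_lt_prod_half hl hne
    have hle := h₁.2 _ _ hfeas
    rw [absDet_trans, absDet_diagAffine] at hle
    have hs : 0 < √(t₁ * t₂) := Real.sqrt_pos.2 (mul_pos ht₁ ht₂)
    -- Equality of the two optimal values makes their geometric mean the optimum again.
    have hprod : √(t₁ * t₂) * ∏ i, √(l i) = t₁ := by
      rw [← Real.sqrt_prod _ fun i _ => (hl i).le, ← Real.sqrt_mul (mul_pos ht₁ ht₂).le, mul_assoc,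
        ← hval, Real.sqrt_mul_self ht₁.le]
    have h1 : √(t₁ * t₂) * ∏ i, (1 + l i) / 2 ≤ t₁ :=
      le_of_mul_le_mul_right (by linarith) hA
    have h2 := mul_lt_mul_of_pos_left hlt hs
    linarith
  exact ⟨hone, by simpa [hone] using hval⟩

/-- Two solutions with the same height which are translates of each other coincide. -/
theorem IsJohnSolution.translation_eq_zero {f : Eucl n → ℝ} (hf : IsLC f) {t : ℝ}
    {A : NonsingAffine n} {b : Eucl n} (h : IsJohnSolution f t A)
    (hb : ∀ z ∈ Metric.closedBall (0 : Eucl n) 1, t ≤ f (A (z + b))) : b = 0 := by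
  by_contra hne
  have hpos : 0 < ‖b‖ := norm_pos_iff.2 hne
  -- The competitor stretches the ball along b by z ↦ z + (1/2 + φ z) b. The scaling gives |φ z| ≤
  -- 1/2 on the unit ball, so the image lies on the segment from z to z + b, while the determinant
  -- is 1 + ‖b‖/2 > 1.
  let φ : Module.Dual ℝ (Eucl n) := (2 * ‖b‖)⁻¹ • (innerSL ℝ b : Eucl n →L[ℝ] ℝ).toLinearMap
  have hφ : ∀ x, φ x = (2 * ‖b‖)⁻¹ * inner ℝ b x := fun x => rfl
  have hφb : φ b = ‖b‖ / 2 := by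
    rw [hφ, real_inner_self_eq_norm_sq]; field_simp
  have hdet : LinearMap.det (LinearMap.transvection φ b) = 1 + ‖b‖ / 2 := by
    rw [LinearMap.transvection.det, hφb]
  have hdet0 : 0 < 1 + ‖b‖ / 2 := by positivity
  have hfeas : IsJohnFeasible f t ((NonsingAffine.mk' (LinearMap.transvection φ b)
      (by rw [hdet]; exact hdet0.ne') ((1 / 2 : ℝ) • b)).trans A) := by
    rw [hf.isJohnFeasible_iff]
    rintro _ ⟨z, hz, rfl⟩
    have hconv : Convex ℝ (A ⁻¹' {x | t ≤ f x}) := (hf.convex_le t).affine_preimage A.toAffineMap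
    have hz' : ‖z‖ ≤ 1 := by simpa using hz
    have hφz : |φ z| ≤ 1 / 2 := by
      rw [hφ, abs_mul, abs_of_pos (by positivity), inv_mul_le_iff₀ (by positivity)]
      nlinarith [abs_real_inner_le_norm b z]
    have h1 := hconv.add_smul_mem (hf.isJohnFeasible_iff.1 h.1 _ ⟨z, hz, rfl⟩) (hb z hz)
      (t := 1 / 2 + φ z) ⟨by linarith [abs_le.1 hφz], by linarith [abs_le.1 hφz]⟩
    rw [AffineEquiv.trans_apply, NonsingAffine.mk'_apply, LinearMap.transvection.apply]
    have h2 : z + φ z • b + (1 / 2 : ℝ) • b = z + (1 / 2 + φ z) • b := by rw [add_smul]; abel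
    rw [h2]
    exact h1
  have hle := h.2 _ _ hfeas
  rw [absDet_trans, NonsingAffine.absDet_mk', hdet, abs_of_pos hdet0] at hle
  nlinarith [mul_pos (h.pos hf) (mul_pos (absDet_pos A) hpos)]

/-- Uniqueness of the John function. -/
theorem IsJohnSolution.unique {f : Eucl n → ℝ} (hf : IsLC f) {t₁ t₂ : ℝ} {A₁ A₂ : NonsingAffine n}
    (h₁ : IsJohnSolution f t₁ A₁) (h₂ : IsJohnSolution f t₂ A₂) :
    t₁ = t₂ ∧ ellipsoid A₁ = ellipsoid A₂ := by
  obtain ⟨u, l, hl, b, hC⟩ := exists_ellipsoid_eq_diagAffine (A₂.trans A₁.symm)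
  have hE : ellipsoid A₂ = ellipsoid ((diagAffine u l hl b).trans A₁) := by
    rw [ellipsoid_trans, ← hC, ellipsoid_trans, Set.image_image]
    simp
  have h₂' : IsJohnSolution f t₂ ((diagAffine u l hl b).trans A₁) := by
    refine ⟨hf.isJohnFeasible_iff.2 fun x hx => hf.isJohnFeasible_iff.1 h₂.1 x (hE ▸ hx), ?_⟩
    rw [← absDet_eq_of_ellipsoid_eq hE]
    exact h₂.2
  obtain ⟨hone, rfl⟩ := h₁.semiaxes_eq_one hf h₂'
  have hid : ∀ z, diagAffine u l hl b z = z + b := fun z => by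
    rw [diagAffine_apply]
    congr 1
    apply u.repr.injective
    ext i
    rw [repr_diagMap, hone, one_mul]
  have hb : b = 0 := h₁.translation_eq_zero hf fun z hz => by
    rw [← hid]
    exact hf.isJohnFeasible_iff.1 h₂'.1 _ ⟨z, hz, rfl⟩
  refine ⟨rfl, ?_⟩
  rw [hE, ellipsoid_trans, ellipsoid, ellipsoid]
  have hid' : ⇑(diagAffine u l hl b) = id := funext fun z => (hid z).trans (by rw [hb, add_zero, id])
  rw [hid', Set.image_id]

/-! ### Integral estimates -/

theorem volume_real_closedBall_pos (x : Eucl n) {r : ℝ} (hr : 0 < r) :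
    0 < volume.real (Metric.closedBall x r) :=
  ENNReal.toReal_pos (Metric.measure_closedBall_pos volume _ hr).ne' measure_closedBall_lt_top.ne

theorem volume_real_closedBall_center (x : Eucl n) (r : ℝ) :
    volume.real (Metric.closedBall x r) = volume.real (Metric.closedBall (0 : Eucl n) r) := by
  rw [measureReal_def, measureReal_def, Measure.addHaar_closedBall_center]

namespace IsLC

variable {f g : Eucl n → ℝ}

theorem const_mul_le_setIntegral (hf : IsLC f) {S U : Set (Eucl n)} {c : ℝ} (hS : IsCompact S)
    (hSU : S ⊆ U) (h : ∀ x ∈ S, c ≤ f x) :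
    c * volume.real S ≤ ∫ x in U, f x :=
  (setIntegral_ge_of_const_le_real hS.measurableSet hS.measure_lt_top.ne h
    hf.integrable.integrableOn).trans
    (setIntegral_mono_set hf.integrable.integrableOn (ae_of_all _ hf.nonneg) hSU.eventuallyLE)

theorem const_mul_le_integral (hf : IsLC f) {S : Set (Eucl n)} {c : ℝ} (hS : IsCompact S)
    (h : ∀ x ∈ S, c ≤ f x) : c * volume.real S ≤ ∫ x, f x := by
  simpa using hf.const_mul_le_setIntegral hS (Set.subset_univ _) h

/-- If `f` is small at the centre of a ball on which `g` is large, then `f` is small on half of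
this ball, and `f` is far from `g`. -/
theorem mul_volume_le_integral_abs_sub (hf : IsLC f) (hg : IsLC g) {y : Eucl n} {ρ s t : ℝ}
    (hst : s ≤ t) (hgt : ∀ x ∈ Metric.closedBall y ρ, t ≤ g x) (hfs : f y < s) :
    (t - s) * volume.real (Metric.closedBall (0 : Eucl n) ρ) ≤ 2 * ∫ x, |f x - g x| := by
  set K := Metric.closedBall y ρ
  set bad := K ∩ {x | f x < s}
  have hbad : MeasurableSet bad :=
    Metric.isClosed_closedBall.measurableSet.inter (measurableSet_lt hf.measurable measurable_const)
  have hfin : volume bad ≠ ∞ :=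
    measure_ne_top_of_subset Set.inter_subset_left measure_closedBall_lt_top.ne
  -- Of x and its reflection 2y - x, at least one has f < s: otherwise convexity of the superlevel
  -- set would force f y ≥ s. So `bad` has at least half the volume of the ball.
  have hcov : K ⊆ bad ∪ (fun x => y + y - x) ⁻¹' bad := fun x hx => by
    have hx' : y + y - x ∈ K := by
      rw [mem_closedBall_iff_norm] at hx ⊢
      rw [show y + y - x - y = -(x - y) by abel, norm_neg]
      exact hx
    by_contra hcon
    simp only [Set.mem_union, Set.mem_preimage, bad, Set.mem_inter_iff, hx, hx', true_and,
      Set.mem_ofPred_eq, not_or, not_lt] at hcon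
    have h := (hf.convex_le s).midpoint_mem (x := x) (y := y + y - x) hcon.1 hcon.2
    rw [midpoint_eq_smul_add, show x + (y + y - x) = (2 : ℝ) • y by rw [two_smul]; abel,
      invOf_smul_smul] at h
    exact absurd h (not_le.2 hfs)
  have hvol : volume.real K ≤ 2 * volume.real bad := by
    have hpre := (Measure.measurePreserving_sub_left (volume : Measure (Eucl n)) (y + y)).measure_preimage
      hbad.nullMeasurableSet
    have h2 : volume.real ((fun x => y + y - x) ⁻¹' bad) = volume.real bad := by
      rw [measureReal_def, hpre, measureReal_def]
    calc volume.real K ≤ volume.real (bad ∪ (fun x => y + y - x) ⁻¹' bad) :=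
          measureReal_mono hcov (measure_union_ne_top hfin (by rw [hpre]; exact hfin))
      _ ≤ _ := (measureReal_union_le _ _).trans (by rw [h2, two_mul])
  have hint : Integrable (fun x => |f x - g x|) volume := (hf.integrable.sub hg.integrable).abs
  have h1 : (t - s) * volume.real bad ≤ ∫ x, |f x - g x| := by
    refine (setIntegral_ge_of_const_le_real hbad hfin (f := fun x => |f x - g x|) (fun x hx => ?_)
      hint.integrableOn).trans (setIntegral_le_integral hint (ae_of_all _ fun x => abs_nonneg _))
    have h3 : f x < s := hx.2
    have h4 := hgt x hx.1
    rw [abs_sub_comm]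
    exact le_trans (by linarith) (le_abs_self _)
  rw [← volume_real_closedBall_center y]
  nlinarith [mul_le_mul_of_nonneg_left hvol (sub_nonneg.2 hst)]

/-- Log-concavity propagates a lower bound on a ball towards any other point. -/
theorem sqrt_le_of_mem_closedBall_midpoint (hf : IsLC f) {x₀ y : Eucl n} {r a s : ℝ}
    (ha : ∀ x ∈ Metric.closedBall x₀ r, a ≤ f x) (hs : 0 ≤ s) (hy : s ≤ f y) :
    ∀ z ∈ Metric.closedBall (midpoint ℝ x₀ y) (r / 2), √(a * s) ≤ f z := by
  intro z hz
  have hz' : midpoint ℝ ((2 : ℝ) • z - y) y = z := by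
    rw [midpoint_eq_smul_add, sub_add_cancel, invOf_smul_smul]
  rw [← hz']
  refine hf.sqrt_mul_le_midpoint hs (ha _ ?_) hy
  rw [mem_closedBall_iff_norm] at hz ⊢
  have h : (2 : ℝ) • z - y - x₀ = (2 : ℝ) • (z - midpoint ℝ x₀ y) := by
    rw [midpoint_eq_smul_add, smul_sub, smul_invOf_smul]; abel
  rw [h, norm_smul, Real.norm_two]
  linarith

/-- Log-concavity propagates a lower bound on an ellipsoid towards any other point. -/
theorem sqrt_mul_absDet_le_integral (hf : IsLC f) {x₀ : Eucl n} {a t : ℝ} (ha : a ≤ f x₀)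
    (ht : 0 ≤ t) {A : NonsingAffine n} (hA : ∀ x ∈ ellipsoid A, t ≤ f x) :
    √(a * t) * ((1 / 2) ^ n * absDet A * volume.real (Metric.closedBall (0 : Eucl n) 1))
      ≤ ∫ x, f x := by
  have hdet : LinearMap.det ((1 / 2 : ℝ) • LinearMap.id : Eucl n →ₗ[ℝ] Eucl n) = (1 / 2) ^ n := by
    rw [LinearMap.det_smul, LinearMap.det_id, mul_one, finrank_euclideanSpace_fin]
  -- Homothety of ratio 1/2 centred at x₀; it sends x to the midpoint of x₀ and x.
  let H : NonsingAffine n := .mk' _ (by rw [hdet]; positivity) ((1 / 2 : ℝ) • x₀)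
  have hH : absDet H = (1 / 2) ^ n := by
    rw [NonsingAffine.absDet_mk', hdet, abs_of_pos (by positivity)]
  rw [← hH, ← absDet_trans, ← volume_real_ellipsoid]
  refine hf.const_mul_le_integral (isCompact_ellipsoid _) ?_
  rw [ellipsoid_trans]
  rintro _ ⟨x, hx, rfl⟩
  have h := hf.sqrt_mul_le_midpoint ht ha (hA x hx)
  rw [midpoint_eq_smul_add, smul_add, add_comm, invOf_eq_inv, ← one_div] at h
  rwa [NonsingAffine.mk'_apply, LinearMap.smul_apply, LinearMap.id_apply]

/-- The mass of an integrable function far away from the origin is small. -/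
theorem exists_setIntegral_compl_closedBall_lt (hf : IsLC f) {ε : ℝ} (hε : 0 < ε) :
    ∃ R : ℝ, ∫ x in (Metric.closedBall (0 : Eucl n) R)ᶜ, f x < ε := by
  have h := tendsto_setIntegral_of_antitone (μ := volume) (f := f)
    (s := fun k : ℕ => (Metric.closedBall (0 : Eucl n) k)ᶜ)
    (fun k => Metric.isClosed_closedBall.measurableSet.compl)
    (fun i j hij => Set.compl_subset_compl.2 (Metric.closedBall_subset_closedBall (by exact_mod_cast hij)))
    ⟨0, hf.integrable.integrableOn⟩
  have hempty : ⋂ k : ℕ, (Metric.closedBall (0 : Eucl n) k)ᶜ = ∅ := by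
    rw [← Set.compl_iUnion, Metric.iUnion_closedBall_nat, Set.compl_univ]
  rw [hempty, setIntegral_empty] at h
  obtain ⟨k, hk⟩ := (h.eventually (gt_mem_nhds hε)).exists
  exact ⟨k, hk⟩

end IsLC

/-! ### Consequences of L₁ convergence -/

theorem TendstoL1.tendsto_integral {f : ℕ → LC n} {g : LC n} (h : TendstoL1 f g) :
    Tendsto (fun m => ∫ x, |(f m).1 x - g.1 x|) atTop (𝓝 0) := by
  have h1 := (ENNReal.tendsto_toReal ENNReal.zero_ne_top).comp h
  refine h1.congr fun m => ?_
  rw [Function.comp_apply, eLpNorm_one_eq_lintegral_enorm,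
    ← integral_norm_eq_lintegral_enorm ((f m).2.integrable.sub g.2.integrable).aestronglyMeasurable]
  rfl

theorem IsLC.setIntegral_le_add {f g : Eucl n → ℝ} (hf : IsLC f) (hg : IsLC g)
    (U : Set (Eucl n)) : ∫ x in U, f x ≤ (∫ x in U, g x) + ∫ x, |f x - g x| := by
  have hint : Integrable (fun x => |f x - g x|) volume := (hf.integrable.sub hg.integrable).abs
  calc ∫ x in U, f x ≤ ∫ x in U, (g x + |f x - g x|) :=
        integral_mono hf.integrable.integrableOn
          (hg.integrable.integrableOn.add hint.integrableOn)
          (fun x => by dsimp only; linarith [le_abs_self (f x - g x)])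
    _ = (∫ x in U, g x) + ∫ x in U, |f x - g x| :=
        integral_add hg.integrable.integrableOn hint.integrableOn
    _ ≤ _ := add_le_add_right (setIntegral_le_integral hint (ae_of_all _ fun x => abs_nonneg _)) _

/-- Lower bounds of the limit pass to the approximating functions. -/
theorem TendstoL1.eventually_le {f : ℕ → LC n} {g : LC n} (h : TendstoL1 f g) {S : Set (Eucl n)}
    {ρ s t : ℝ} (hρ : 0 < ρ) (hst : s < t)
    (hS : ∀ y ∈ S, ∀ x ∈ Metric.closedBall y ρ, t ≤ g.1 x) :
    ∀ᶠ m in atTop, ∀ y ∈ S, s ≤ (f m).1 y := by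
  -- This threshold does not depend on y, so the same m serve all of S.
  have hpos : 0 < (t - s) * volume.real (Metric.closedBall (0 : Eucl n) ρ) / 2 :=
    half_pos (mul_pos (sub_pos.2 hst) (volume_real_closedBall_pos _ hρ))
  filter_upwards [h.tendsto_integral.eventually (gt_mem_nhds hpos)] with m hm y hy
  by_contra! hlt
  have := (f m).2.mul_volume_le_integral_abs_sub g.2 hst.le (hS y hy) hlt
  linarith

/-- Feasible pairs with value bounded away from zero stay in a bounded region. -/
theorem TendstoL1.eventually_isJohnFeasible_bounds {f : ℕ → LC n} {g : LC n} (h : TendstoL1 f g)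
    {c : ℝ} (hc : 0 < c) :
    ∃ T R : ℝ, ∀ᶠ m in atTop, ∀ (t : ℝ) (A : NonsingAffine n), IsJohnFeasible (f m).1 t A →
      c ≤ t * absDet A → 0 ≤ t ∧ t ≤ T ∧ ∀ x ∈ ellipsoid A, ‖x‖ ≤ R := by
  obtain ⟨x₀, r, b, hr, hb, hball⟩ := g.2.exists_closedBall_le
  set a := b / 2
  have ha : 0 < a := half_pos hb
  have hlow : ∀ᶠ m in atTop, ∀ y ∈ Metric.closedBall x₀ (r / 2), a ≤ (f m).1 y := by
    refine h.eventually_le (half_pos hr) (half_lt_self hb) fun y hy x hx => hball x ?_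
    rw [Metric.mem_closedBall] at *
    linarith [dist_triangle x y x₀]
  set C := (∫ x, g.1 x) + 1
  have hC : 0 < C := add_pos_of_nonneg_of_pos (integral_nonneg g.2.nonneg) one_pos
  have hint : ∀ᶠ m in atTop, ∫ x, (f m).1 x ≤ C := by
    filter_upwards [h.tendsto_integral.eventually (gt_mem_nhds one_pos)] with m hm
    have := (f m).2.setIntegral_le_add g.2 Set.univ
    simp only [setIntegral_univ] at this
    simp only [C]
    linarith
  set v := volume.real (Metric.closedBall (0 : Eucl n) (r / 2 / 2))
  have hv : 0 < v := volume_real_closedBall_pos _ (by positivity)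
  set v₁ := volume.real (Metric.closedBall (0 : Eucl n) 1)
  have hv₁ : 0 < v₁ := volume_real_closedBall_pos _ one_pos
  -- A lower bound for √(at): multiply √(at) 2⁻ⁿ |det A| v₁ ≤ C by √(at) and use t |det A| ≥ c.
  set q := a * c * ((1 / 2) ^ n * v₁) / C
  have hq : 0 < q := by positivity
  obtain ⟨R, hR⟩ := g.2.exists_setIntegral_compl_closedBall_lt (ε := q * v / 2) (by positivity)
  have htail : ∀ᶠ m in atTop, ∫ x in (Metric.closedBall (0 : Eucl n) R)ᶜ, (f m).1 x < q * v := by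
    filter_upwards [h.tendsto_integral.eventually (gt_mem_nhds
      (show 0 < q * v / 2 by positivity))] with m hm
    have := (f m).2.setIntegral_le_add g.2 (Metric.closedBall (0 : Eucl n) R)ᶜ
    linarith
  -- The height bound comes from √(at) v ≤ C, the mass of a ball halfway between x₀ and a point of
  -- the ellipsoid.
  refine ⟨(C / v) ^ 2 / a, 2 * (R + r) + ‖x₀‖, ?_⟩
  filter_upwards [hlow, hint, htail] with m hlow hint htail t A hfeas hct
  have hA := absDet_pos A
  have ht : 0 < t := pos_of_mul_pos_left (hc.trans_le hct) hA.le
  have hmid : ∀ y ∈ ellipsoid A, ∀ z ∈ Metric.closedBall (midpoint ℝ x₀ y) (r / 2 / 2),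
      √(a * t) ≤ (f m).1 z := fun y hy =>
    (f m).2.sqrt_le_of_mem_closedBall_midpoint hlow ht.le ((f m).2.isJohnFeasible_iff.1 hfeas y hy)
  have hcompact := fun y : Eucl n => isCompact_closedBall (midpoint ℝ x₀ y) (r / 2 / 2)
  have hsq : √(a * t) ^ 2 = a * t := Real.sq_sqrt (by positivity)
  refine ⟨ht.le, ?_, fun y hy => ?_⟩
  · have h0 : A 0 ∈ ellipsoid A := ⟨0, by simp, rfl⟩
    have h1 := ((f m).2.const_mul_le_integral (hcompact _) (hmid _ h0)).trans hint
    rw [volume_real_closedBall_center, ← le_div_iff₀ hv] at h1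
    rw [le_div_iff₀ ha, mul_comm, ← hsq]
    exact pow_le_pow_left₀ (Real.sqrt_nonneg _) h1 2
  · have h1 := ((f m).2.sqrt_mul_absDet_le_integral (hlow x₀ (Metric.mem_closedBall_self (by positivity))) ht.le
      ((f m).2.isJohnFeasible_iff.1 hfeas)).trans hint
    have h2 : q ≤ √(a * t) := by
      rw [div_le_iff₀ hC]
      calc a * c * ((1 / 2) ^ n * v₁) ≤ a * (t * absDet A) * ((1 / 2) ^ n * v₁) := by gcongr
        _ = √(a * t) * (√(a * t) * ((1 / 2) ^ n * absDet A * v₁)) := by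
          rw [← mul_assoc √(a * t), ← sq, hsq]; ring
        _ ≤ √(a * t) * C := by gcongr
    by_contra! hlt
    -- If y is too far out, the halfway ball carries mass at least q v outside radius R,
    -- contradicting the tail bound.
    have hout : Metric.closedBall (midpoint ℝ x₀ y) (r / 2 / 2)
        ⊆ (Metric.closedBall (0 : Eucl n) R)ᶜ := fun z hz hz' => by
      rw [mem_closedBall_iff_norm] at hz hz'
      rw [sub_zero] at hz'
      have h3 : y = (2 : ℝ) • midpoint ℝ x₀ y - x₀ := by
        rw [midpoint_eq_smul_add, smul_invOf_smul]; abel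
      have h4 : ‖y‖ ≤ 2 * ‖midpoint ℝ x₀ y‖ + ‖x₀‖ := by
        conv_lhs => rw [h3]
        exact (norm_sub_le _ _).trans (by rw [norm_smul, Real.norm_two])
      have h5 := norm_sub_norm_le (midpoint ℝ x₀ y) z
      rw [norm_sub_rev] at h5
      linarith
    have h3 := (f m).2.const_mul_le_setIntegral (hcompact y)
      hout fun z hz => h2.trans (hmid y hy z hz)
    rw [volume_real_closedBall_center] at h3
    linarith

/-! ### Convergence and compactness of affine maps -/

namespace NonsingAffine

/-- The linear part, as a continuous linear equivalence. -/
noncomputable def toCLE (A : NonsingAffine n) : Eucl n ≃L[ℝ] Eucl n :=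
  A.linear.toContinuousLinearEquiv

theorem apply_eq_toCLE (A : NonsingAffine n) (x : Eucl n) : A x = A.toCLE x + A 0 := A.apply_eq x

theorem symm_apply_eq_toCLE (A : NonsingAffine n) (x : Eucl n) :
    A.symm x = A.toCLE.symm (x - A 0) := by
  rw [AffineEquiv.symm_apply_eq, A.apply_eq_toCLE (A.toCLE.symm _),
    ContinuousLinearEquiv.apply_symm_apply, sub_add_cancel]

/-- Convergence of affine maps: the linear parts and the translation parts converge. -/
def Converges (A : ℕ → NonsingAffine n) (B : NonsingAffine n) : Prop :=
  Tendsto (fun k => ((A k).toCLE : Eucl n →L[ℝ] Eucl n)) atTop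
      (𝓝 (B.toCLE : Eucl n →L[ℝ] Eucl n)) ∧
    Tendsto (fun k => A k 0) atTop (𝓝 (B 0))

namespace Converges

variable {A : ℕ → NonsingAffine n} {B : NonsingAffine n}

theorem absDet (h : Converges A B) : Tendsto (fun k => absDet (A k)) atTop (𝓝 (_root_.absDet B)) :=
  ((ContinuousLinearMap.continuous_det.tendsto _).comp h.1).abs

/-- Inversion of operators is continuous at invertible ones. -/
theorem symm_apply (h : Converges A B) (x : Eucl n) :
    Tendsto (fun k => (A k).symm x) atTop (𝓝 (B.symm x)) := by
  have h1 := (contDiffAt_map_inverse (n := 0) B.toCLE).continuousAt.tendsto.comp h.1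
  simp only [Function.comp_def, ContinuousLinearMap.inverse_equiv] at h1
  have h2 := (isBoundedBilinearMap_apply.continuous.tendsto _).comp
    (h1.prodMk_nhds ((tendsto_const_nhds (x := x)).sub h.2))
  simpa only [Function.comp_def, ContinuousLinearEquiv.coe_coe, ← symm_apply_eq_toCLE] using h2

/-- Membership means ‖A⁻¹x‖ ≤ 1, which survives perturbation when the inequality is strict; hence
the open ball. -/
theorem eventually_mem_ellipsoid (h : Converges A B) {x : Eucl n} (hx : x ∈ B '' Metric.ball 0 1) :
    ∀ᶠ k in atTop, x ∈ ellipsoid (A k) := by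
  obtain ⟨z, hz, rfl⟩ := hx
  have h1 := (h.symm_apply (B z)).norm
  rw [AffineEquiv.symm_apply_apply] at h1
  filter_upwards [h1.eventually (gt_mem_nhds (by simpa using hz))] with k hk
  exact mem_ellipsoid_iff.2 hk.le

theorem eventually_notMem_ellipsoid (h : Converges A B) {x : Eucl n} (hx : x ∉ ellipsoid B) :
    ∀ᶠ k in atTop, x ∉ ellipsoid (A k) := by
  rw [mem_ellipsoid_iff, not_le] at hx
  filter_upwards [(h.symm_apply x).norm.eventually (lt_mem_nhds hx)] with k hk
  rw [mem_ellipsoid_iff, not_le]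
  exact hk

end Converges

/-- Affine maps that map the unit ball into a fixed ball and have determinant bounded away from
zero subconverge, together with a bounded sequence of scalars. -/
theorem exists_converges_subseq {t : ℕ → ℝ} {A : ℕ → NonsingAffine n} {c T R : ℝ} (hc : 0 < c)
    (h : ∀ᶠ k in atTop, 0 ≤ t k ∧ t k ≤ T ∧ ∀ x ∈ ellipsoid (A k), ‖x‖ ≤ R)
    (hA : ∀ k, c ≤ t k * _root_.absDet (A k)) :
    ∃ (φ : ℕ → ℕ) (t₀ : ℝ) (B : NonsingAffine n), StrictMono φ ∧
      Tendsto (t ∘ φ) atTop (𝓝 t₀) ∧ Converges (A ∘ φ) B := by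
  let X : ℕ → ℝ × (Eucl n →L[ℝ] Eucl n) × Eucl n := fun k => (t k, (A k).toCLE, A k 0)
  -- The radius 2R comes from L z = A z - A 0, with both terms of norm at most R.
  have hX : ∀ᶠ k in atTop, X k ∈
      Metric.closedBall (0 : ℝ) T ×ˢ Metric.closedBall (0 : Eucl n →L[ℝ] Eucl n) (2 * R) ×ˢ
        Metric.closedBall (0 : Eucl n) R := by
    filter_upwards [h] with k ⟨h0, hT, hR⟩
    have hb : ‖A k 0‖ ≤ R := hR _ ⟨0, by simp, rfl⟩
    refine ⟨?_, ?_, ?_⟩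
    · simpa [X, abs_of_nonneg h0] using hT
    · rw [mem_closedBall_zero_iff]
      refine ContinuousLinearMap.opNorm_le_of_unit_norm (by linarith [norm_nonneg (A k 0)])
        fun z hz => ?_
      have h1 : (A k).toCLE z = A k z - A k 0 := by rw [(A k).apply_eq_toCLE z, add_sub_cancel_right]
      have h2 : ‖A k z‖ ≤ R := hR _ ⟨z, by simp [hz], rfl⟩
      change ‖(A k).toCLE z‖ ≤ _
      rw [h1]
      linarith [norm_sub_le (A k z) (A k 0)]
    · simpa [X] using hb
  obtain ⟨⟨t₀, L, b⟩, -, φ, hφ, hlim⟩ := tendsto_subseq_of_frequently_bounded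
    (Metric.isBounded_closedBall.prod (Metric.isBounded_closedBall.prod Metric.isBounded_closedBall))
    hX.frequently
  rw [nhds_prod_eq, nhds_prod_eq, tendsto_prod_iff'] at hlim
  obtain ⟨ht, hlim⟩ := hlim
  rw [tendsto_prod_iff'] at hlim
  obtain ⟨hL, hb⟩ := hlim
  have hdet : Tendsto (fun k => _root_.absDet (A (φ k))) atTop (𝓝 |L.det|) :=
    ((ContinuousLinearMap.continuous_det.tendsto L).comp hL).abs
  -- The lower bound on the values passes to the limit and keeps L invertible.
  have hval : c ≤ t₀ * |L.det| := ge_of_tendsto' (ht.mul hdet) fun k => hA (φ k)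
  have hne : LinearMap.det (L : Eucl n →ₗ[ℝ] Eucl n) ≠ 0 := fun h0 => by
    have h1 : L.det = 0 := h0
    rw [h1, abs_zero, mul_zero] at hval
    exact absurd hval (not_le.2 hc)
  have hmk : ((mk' (L : Eucl n →ₗ[ℝ] Eucl n) hne b).toCLE : Eucl n →L[ℝ] Eucl n) = L :=
    ContinuousLinearMap.ext fun z =>
      LinearMap.congr_fun (mk'_linear (L : Eucl n →ₗ[ℝ] Eucl n) hne b) z
  refine ⟨φ, t₀, .mk' L hne b, hφ, ht, ?_, ?_⟩
  · rw [hmk]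
    exact hL
  · rw [mk'_apply, map_zero, zero_add]
    exact hb

end NonsingAffine

/-! ### Closedness of feasibility and existence -/

theorem TendstoL1.comp {f : ℕ → LC n} {g : LC n} (h : TendstoL1 f g) {φ : ℕ → ℕ}
    (hφ : Tendsto φ atTop atTop) : TendstoL1 (f ∘ φ) g :=
  Tendsto.comp (g := fun m => eLpNorm ((f m).1 - g.1) 1 volume) h hφ

/-- Feasibility is a closed condition. -/
theorem TendstoL1.isJohnFeasible {f : ℕ → LC n} {g : LC n} (h : TendstoL1 f g) {t : ℕ → ℝ}
    {A : ℕ → NonsingAffine n} {t₀ : ℝ} {B : NonsingAffine n} (ht : Tendsto t atTop (𝓝 t₀))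
    (hA : NonsingAffine.Converges A B) (hf : ∀ k, IsJohnFeasible (f k).1 (t k) (A k)) :
    IsJohnFeasible g.1 t₀ B := by
  obtain ⟨ψ, hψ, hae⟩ := (tendstoInMeasure_of_tendsto_eLpNorm one_ne_zero
    (fun m => (f m).2.integrable.aestronglyMeasurable)
    g.2.integrable.aestronglyMeasurable h).exists_seq_tendsto_ae
  have hU : IsOpen (B '' Metric.ball 0 1) := B.isOpenMap _ Metric.isOpen_ball
  have hle : ∀ᵐ x ∂volume, x ∈ B '' Metric.ball 0 1 → t₀ ≤ g.1 x := by
    filter_upwards [hae] with x hx hxU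
    refine le_of_tendsto_of_tendsto (ht.comp hψ.tendsto_atTop) hx ?_
    filter_upwards [hψ.tendsto_atTop.eventually (hA.eventually_mem_ellipsoid hxU)] with k hk
    exact (f _).2.isJohnFeasible_iff.1 (hf _) x hk
  have hlt : IsOpen {x | g.1 x < t₀} := g.2.upperSemicontinuous.isOpen_preimage t₀
  -- Almost everywhere convergence along a subsequence only gives a null set; upper semicontinuity
  -- makes it open, hence empty. Closedness of {g ≥ t₀} then adds the boundary of the ellipsoid.
  have hempty : B '' Metric.ball 0 1 ∩ {x | g.1 x < t₀} = ∅ := by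
    rw [← (hU.inter hlt).measure_eq_zero_iff volume]
    refine measure_mono_null (fun x hx => ?_) (ae_iff.1 hle)
    exact fun hcon => absurd (hcon hx.1) (not_le.2 hx.2)
  rw [g.2.isJohnFeasible_iff, ellipsoid, ← closure_ball (0 : Eucl n) one_ne_zero]
  intro x hx
  have hcl : closure (B '' Metric.ball 0 1) ⊆ {x | g.1 x < t₀}ᶜ :=
    closure_minimal (fun y hy hy' => (hempty ▸ (⟨hy, hy'⟩ : y ∈ _ ∩ {x | g.1 x < t₀}) :
      y ∈ (∅ : Set (Eucl n)))) hlt.isClosed_compl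
  exact not_lt.1 (hcl (image_closure_subset_closure_image B.continuous hx))

/-- Compactness of sequences of feasible pairs. -/
theorem TendstoL1.exists_subseq {f : ℕ → LC n} {g : LC n} (h : TendstoL1 f g) {t : ℕ → ℝ}
    {A : ℕ → NonsingAffine n} {c : ℝ} (hc : 0 < c) (hA : ∀ k, c ≤ t k * absDet (A k))
    (hf : ∀ k, IsJohnFeasible (f k).1 (t k) (A k)) :
    ∃ (φ : ℕ → ℕ) (t₀ : ℝ) (B : NonsingAffine n), StrictMono φ ∧
      Tendsto (t ∘ φ) atTop (𝓝 t₀) ∧ NonsingAffine.Converges (A ∘ φ) B ∧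
      IsJohnFeasible g.1 t₀ B := by
  obtain ⟨T, R, hTR⟩ := h.eventually_isJohnFeasible_bounds hc
  obtain ⟨φ, t₀, B, hφ, ht, hB⟩ := NonsingAffine.exists_converges_subseq hc
    (hTR.mono fun k hk => hk _ _ (hf k) (hA k)) hA
  exact ⟨φ, t₀, B, hφ, ht, hB, (h.comp hφ.tendsto_atTop).isJohnFeasible ht hB fun k => hf (φ k)⟩

theorem IsJohnFeasible.mul_absDet_le {f : Eucl n → ℝ} (hf : IsLC f) {t : ℝ} {A : NonsingAffine n}
    (h : IsJohnFeasible f t A) :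
    t * absDet A ≤ (∫ x, f x) / volume.real (Metric.closedBall (0 : Eucl n) 1) := by
  rw [le_div_iff₀ (volume_real_closedBall_pos _ one_pos), mul_assoc, ← volume_real_ellipsoid]
  exact hf.const_mul_le_integral (isCompact_ellipsoid A) (hf.isJohnFeasible_iff.1 h)

/-- Existence of a solution. -/
theorem LC.exists_isJohnSolution (f : LC n) : ∃ t A, IsJohnSolution f.1 t A := by
  let V : Set ℝ := {v | ∃ t A, IsJohnFeasible f.1 t A ∧ v = t * absDet A}
  have hbdd : BddAbove V := ⟨_, by rintro _ ⟨t, A, h, rfl⟩; exact h.mul_absDet_le f.2⟩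
  obtain ⟨s, B, hs, hB⟩ := f.2.exists_isJohnFeasible_pos
  have hpos : 0 < sSup V :=
    (mul_pos hs (absDet_pos B)).trans_le (le_csSup hbdd ⟨s, B, hB, rfl⟩)
  have hV : V.Nonempty := ⟨_, s, B, hB, rfl⟩
  -- A maximizing sequence whose gap vanishes and whose values never fall below half the supremum,
  -- as compactness requires.
  have happ : ∀ k : ℕ, ∃ t A, IsJohnFeasible f.1 t A ∧
      sSup V - sSup V / 2 * (1 / (k + 1 : ℝ)) < t * absDet A := fun k => by
    obtain ⟨_, ⟨t, A, h, rfl⟩, hlt⟩ := exists_lt_of_lt_csSup hV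
      (show sSup V - sSup V / 2 * (1 / (k + 1 : ℝ)) < sSup V by
        have : 0 < sSup V / 2 * (1 / (k + 1 : ℝ)) := by positivity
        linarith)
    exact ⟨t, A, h, hlt⟩
  choose t A hfeas hlt using happ
  have hconst : TendstoL1 (fun _ => f) f := by
    simp [TendstoL1]
  obtain ⟨φ, t₀, A₀, hφ, ht, hA, hf₀⟩ := hconst.exists_subseq (half_pos hpos) (t := t) (A := A)
    (fun k => by
      have h1 : (1 : ℝ) / (k + 1) ≤ 1 := by
        rw [div_le_one (by positivity)]; linarith [(Nat.cast_nonneg k : (0 : ℝ) ≤ k)]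
      nlinarith [hlt k]) hfeas
  refine ⟨t₀, A₀, hf₀, fun s B hB => (le_csSup hbdd ⟨s, B, hB, rfl⟩).trans ?_⟩
  have hlim : Tendsto (fun k => sSup V - sSup V / 2 * (1 / ((φ k : ℕ) + 1 : ℝ))) atTop
      (𝓝 (sSup V - sSup V / 2 * 0)) :=
    tendsto_const_nhds.sub (tendsto_const_nhds.mul
      (tendsto_one_div_add_atTop_nhds_zero_nat.comp hφ.tendsto_atTop))
  rw [mul_zero, sub_zero] at hlim
  exact le_of_tendsto_of_tendsto' hlim (ht.mul hA.absDet) fun k => (hlt (φ k)).le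

/-! ### Convergence of optimal pairs -/

/-- Optimal values are lower semicontinuous. -/
theorem TendstoL1.eventually_value_le {f : ℕ → LC n} {g : LC n} (h : TendstoL1 f g) {t v : ℝ}
    {A : NonsingAffine n} (ht : 0 < t) (hA : IsJohnFeasible g.1 t A) (hv : v < t * absDet A) :
    ∀ᶠ m in atTop, ∃ s B, IsJohnFeasible (f m).1 s B ∧ v ≤ s * absDet B := by
  -- Shrink both height and ellipsoid by 1 - δ: this leaves room in height and in space for
  -- `TendstoL1.eventually_le`, at an arbitrarily small cost in value.
  have hcont : Tendsto (fun δ : ℝ => (1 - δ) * t * ((1 - δ) ^ n * absDet A)) (𝓝[>] 0)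
      (𝓝 (t * absDet A)) := by
    have : Continuous fun δ : ℝ => (1 - δ) * t * ((1 - δ) ^ n * absDet A) := by fun_prop
    simpa using (this.tendsto 0).mono_left nhdsWithin_le_nhds
  obtain ⟨δ, hδ, hδ0, hδ1⟩ := ((hcont.eventually (lt_mem_nhds hv)).and
    (Ioo_mem_nhdsGT (zero_lt_one' ℝ))).exists
  have hδ' : 0 < 1 - δ := sub_pos.2 hδ1
  have hdet : LinearMap.det ((1 - δ) • LinearMap.id : Eucl n →ₗ[ℝ] Eucl n) = (1 - δ) ^ n := by
    rw [LinearMap.det_smul, LinearMap.det_id, mul_one, finrank_euclideanSpace_fin]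
  let H : NonsingAffine n := .mk' _ (by rw [hdet]; positivity) 0
  have hH : absDet H = (1 - δ) ^ n := by
    rw [NonsingAffine.absDet_mk', hdet, abs_of_pos (by positivity)]
  have hsub : ellipsoid (H.trans A) ⊆ interior (ellipsoid A) := by
    rintro _ ⟨z, hz, rfl⟩
    rw [interior_ellipsoid]
    refine ⟨H z, ?_, rfl⟩
    rw [mem_ball_zero_iff, NonsingAffine.mk'_apply]
    simp only [LinearMap.smul_apply, LinearMap.id_apply, add_zero, norm_smul,
      Real.norm_of_nonneg hδ'.le]
    have hz' : ‖z‖ ≤ 1 := by simpa using hz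
    nlinarith
  obtain ⟨ρ, hρ, hthick⟩ := (isCompact_ellipsoid (H.trans A)).exists_cthickening_subset_open
    isOpen_interior hsub
  have hev := h.eventually_le (S := ellipsoid (H.trans A)) (s := (1 - δ) * t) (t := t) hρ
    (by nlinarith) fun y hy x hx => g.2.isJohnFeasible_iff.1 hA x
      (interior_subset (hthick (Metric.closedBall_subset_cthickening hy ρ hx)))
  filter_upwards [hev] with m hm
  refine ⟨(1 - δ) * t, H.trans A, (f m).2.isJohnFeasible_iff.2 hm, ?_⟩
  rw [absDet_trans, hH, mul_comm (absDet A)]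
  exact hδ.le

theorem isLC_ellipsoidFunction {t : ℝ} (ht : 0 < t) (A : NonsingAffine n) :
    IsLC (ellipsoidFunction t A) := by
  have hclosed := (isCompact_ellipsoid A).isClosed
  refine ⟨⟨ellipsoid A, fun _ => -Real.log t, convexOn_const _ (convex_ellipsoid A), ?_⟩,
    hclosed.upperSemicontinuous_indicator ht.le, ?_, ?_⟩
  · simp only [neg_neg, Real.exp_log ht]
    rfl
  · exact (integrable_indicator_iff hclosed.measurableSet).2
      (integrableOn_const (isCompact_ellipsoid A).measure_lt_top.ne)
  · refine (interior_ellipsoid_nonempty A).mono (interior_mono fun x hx => ?_)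
    simp [ellipsoidFunction, hx, ht.ne']

/-- Dominated convergence: the functions converge pointwise off the boundary of the limit ellipsoid,
which is null by convexity, and share a bounded support and a height bound. -/
theorem NonsingAffine.Converges.tendsto_eLpNorm {t : ℕ → ℝ} {A : ℕ → NonsingAffine n} {t₀ : ℝ}
    {B : NonsingAffine n} (hA : NonsingAffine.Converges A B) (ht : Tendsto t atTop (𝓝 t₀))
    {T R : ℝ} (h : ∀ᶠ k in atTop, 0 ≤ t k ∧ t k ≤ T ∧ ∀ x ∈ ellipsoid (A k), ‖x‖ ≤ R)
    (hB : ∀ x ∈ ellipsoid B, ‖x‖ ≤ R) :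
    Tendsto (fun k => eLpNorm (ellipsoidFunction (t k) (A k) - ellipsoidFunction t₀ B) 1 volume)
      atTop (𝓝 0) := by
  have hmeas : ∀ (t : ℝ) (A : NonsingAffine n), Measurable (ellipsoidFunction t A) := fun t A =>
    measurable_const.indicator (isCompact_ellipsoid A).isClosed.measurableSet
  simp only [eLpNorm_one_eq_lintegral_enorm]
  rw [← lintegral_zero (μ := (volume : Measure (Eucl n)))]
  refine tendsto_lintegral_filter_of_dominated_convergence
    ((Metric.closedBall (0 : Eucl n) R).indicator fun _ => ENNReal.ofReal (T + |t₀|))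
    (Eventually.of_forall fun k => ((hmeas _ _).sub (hmeas _ _)).enorm) ?_ ?_ ?_
  · filter_upwards [h] with k ⟨h0, hT, hR⟩
    refine ae_of_all _ fun x => ?_
    by_cases hx : x ∈ Metric.closedBall (0 : Eucl n) R
    · rw [Set.indicator_of_mem hx, Real.enorm_eq_ofReal_abs]
      refine ENNReal.ofReal_le_ofReal ((abs_sub _ _).trans (add_le_add ?_ ?_))
      · by_cases hk : x ∈ ellipsoid (A k)
        · simpa [ellipsoidFunction, hk, abs_of_nonneg h0] using hT
        · simpa [ellipsoidFunction, hk] using h0.trans hT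
      · by_cases hk : x ∈ ellipsoid B <;> simp [ellipsoidFunction, hk]
    · have h1 : x ∉ ellipsoid (A k) := fun hk => hx (by simpa using hR x hk)
      have h2 : x ∉ ellipsoid B := fun hk => hx (by simpa using hB x hk)
      simp [ellipsoidFunction, h1, h2]
  · rw [lintegral_indicator_const Metric.isClosed_closedBall.measurableSet]
    exact ENNReal.mul_ne_top ENNReal.ofReal_ne_top measure_closedBall_lt_top.ne
  · have hfr := (convex_ellipsoid B).addHaar_frontier volume
    filter_upwards [measure_eq_zero_iff_ae_notMem.1 hfr] with x hx
    have hlim : Tendsto (fun k => ellipsoidFunction (t k) (A k) x) atTop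
        (𝓝 (ellipsoidFunction t₀ B x)) := by
      by_cases hxB : x ∈ ellipsoid B
      · have hxi : x ∈ B '' Metric.ball 0 1 := by
          rw [← interior_ellipsoid]
          by_contra hcon
          exact hx ⟨subset_closure hxB, hcon⟩
        rw [ellipsoidFunction, Set.indicator_of_mem hxB]
        refine ht.congr' ?_
        filter_upwards [hA.eventually_mem_ellipsoid hxi] with k hk
        rw [ellipsoidFunction, Set.indicator_of_mem hk]
      · rw [ellipsoidFunction, Set.indicator_of_notMem hxB]
        refine tendsto_const_nhds.congr' ?_
        filter_upwards [hA.eventually_notMem_ellipsoid hxB] with k hk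
        rw [ellipsoidFunction, Set.indicator_of_notMem hk]
    have h1 := (hlim.sub_const (ellipsoidFunction t₀ B x)).enorm
    simpa using h1

/-- Convergence of John solutions, along a subsequence. -/
theorem TendstoL1.exists_subseq_john {f : ℕ → LC n} {g : LC n} (h : TendstoL1 f g) {t : ℕ → ℝ}
    {A : ℕ → NonsingAffine n} {t₀ : ℝ} {A₀ : NonsingAffine n}
    (hf : ∀ k, IsJohnSolution (f k).1 (t k) (A k)) (hg : IsJohnSolution g.1 t₀ A₀) :
    ∃ φ : ℕ → ℕ, Tendsto (fun k => eLpNorm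
      (ellipsoidFunction (t (φ k)) (A (φ k)) - ellipsoidFunction t₀ A₀) 1 volume) atTop (𝓝 0) := by
  have hv : 0 < t₀ * absDet A₀ := mul_pos (hg.pos g.2) (absDet_pos A₀)
  have hlow : ∀ v < t₀ * absDet A₀, ∀ᶠ m in atTop, v ≤ t m * absDet (A m) := fun v hlt => by
    filter_upwards [h.eventually_value_le (hg.pos g.2) hg.1 hlt] with m ⟨s, B, hB, hs⟩
    exact hs.trans ((hf m).2 s B hB)
  -- Dropping the first N terms makes every remaining value at least half the optimum.
  obtain ⟨N, hN⟩ := eventually_atTop.1 (hlow _ (half_lt_self hv))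
  have hshift := tendsto_add_atTop_nat N
  obtain ⟨φ, s, B, hφ, ht, hB, hfeas⟩ := (h.comp hshift).exists_subseq (half_pos hv)
    (t := fun k => t (k + N)) (A := fun k => A (k + N)) (fun k => hN _ (Nat.le_add_left _ _))
    fun k => (hf _).1
  have hχ : Tendsto (fun k => φ k + N) atTop atTop := hshift.comp hφ.tendsto_atTop
  have hval : t₀ * absDet A₀ ≤ s * absDet B := le_of_forall_lt_imp_le_of_dense fun v hlt =>
    ge_of_tendsto (ht.mul hB.absDet) (hχ.eventually (hlow v hlt))
  have hsol : IsJohnSolution g.1 s B := ⟨hfeas, fun r C hC => (hg.2 r C hC).trans hval⟩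
  obtain ⟨rfl, hE⟩ := hg.unique g.2 hsol
  refine ⟨fun k => φ k + N, ?_⟩
  obtain ⟨T, R, hTR⟩ := h.eventually_isJohnFeasible_bounds (half_pos hv)
  obtain ⟨R', hR'⟩ := (isCompact_ellipsoid B).isBounded.exists_norm_le
  have hfun : ellipsoidFunction t₀ A₀ = ellipsoidFunction t₀ B := by
    rw [ellipsoidFunction, hE, ellipsoidFunction]
  rw [hfun]
  refine hB.tendsto_eLpNorm ht (T := T) (R := max R R') ?_
    fun x hx => (hR' x hx).trans (le_max_right _ _)
  filter_upwards [hχ.eventually hTR] with k hk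
  obtain ⟨h0, hT, hR⟩ := hk _ _ (hf (φ k + N)).1 (hN _ (Nat.le_add_left _ _))
  exact ⟨h0, hT, fun x hx => (hR x hx).trans (le_max_left _ _)⟩

/-! ### Covariance and the theorem -/

theorem IsJohnFunction.eq {f g h : Eucl n → ℝ} (hf : IsLC f) (hg : IsJohnFunction f g)
    (hh : IsJohnFunction f h) : g = h := by
  obtain ⟨t, A, hA, rfl⟩ := hg
  obtain ⟨s, B, hB, rfl⟩ := hh
  obtain ⟨rfl, hE⟩ := hA.unique hf hB
  rw [ellipsoidFunction, hE, ellipsoidFunction]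

theorem IsJohnFeasible.comp_affineEquiv {f : Eucl n → ℝ} (hf : IsLC f) {t : ℝ}
    {B : NonsingAffine n} (h : IsJohnFeasible f t B) (A : NonsingAffine n) :
    IsJohnFeasible (fun x => f (A x)) t (B.trans A.symm) := by
  rw [(hf.comp_affineEquiv A).isJohnFeasible_iff, ellipsoid_trans]
  rintro _ ⟨x, hx, rfl⟩
  simpa using hf.isJohnFeasible_iff.1 h x hx

/-- Composition with A matches the feasible pairs of the two problems and multiplies all values by
the same factor |det A⁻¹|, so maximizers correspond. -/
theorem IsJohnFunction.comp_affineEquiv {f g : Eucl n → ℝ} (hf : IsLC f)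
    (hg : IsJohnFunction f g) (A : NonsingAffine n) :
    IsJohnFunction (fun x => f (A x)) (fun x => g (A x)) := by
  obtain ⟨t, B, hB, rfl⟩ := hg
  refine ⟨t, B.trans A.symm, ⟨hB.1.comp_affineEquiv hf A, fun s C hC => ?_⟩, ?_⟩
  · have h1 : IsJohnFeasible f s (C.trans A) := by
      rw [(hf.comp_affineEquiv A).isJohnFeasible_iff] at hC
      rw [hf.isJohnFeasible_iff, ellipsoid_trans]
      rintro _ ⟨x, hx, rfl⟩
      exact hC x hx
    have h2 := hB.2 _ _ h1
    have h3 : absDet C = absDet A.symm * absDet (C.trans A) := by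
      rw [← absDet_trans]
      congr 1
      ext1 x
      simp
    rw [h3, absDet_trans B]
    nlinarith [mul_le_mul_of_nonneg_left h2 (absDet_pos A.symm).le]
  · ext x
    have : A x ∈ ellipsoid B ↔ x ∈ ellipsoid (B.trans A.symm) := by
      rw [mem_ellipsoid_iff, mem_ellipsoid_iff]
      rfl
    by_cases hx : A x ∈ ellipsoid B
    · simp only [ellipsoidFunction, Set.indicator_of_mem hx, Set.indicator_of_mem (this.1 hx)]
    · simp only [ellipsoidFunction, Set.indicator_of_notMem hx,
        Set.indicator_of_notMem (mt this.2 hx)]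

theorem theorem6p2 (n : ℕ) :
    ∃ J : LC n → LC n,
      (∀ (f : LC n) (g : Eucl n → ℝ), IsJohnFunction f.1 g ↔ g = (J f).1) ∧
      IsAffineCovariant J := by
  choose t A hA using LC.exists_isJohnSolution (n := n)
  have hJ : ∀ f : LC n, IsJohnFunction f.1 (ellipsoidFunction (t f) (A f)) :=
    fun f => ⟨_, _, hA f, rfl⟩
  refine ⟨fun f => ⟨ellipsoidFunction (t f) (A f), isLC_ellipsoidFunction ((hA f).pos f.2) _⟩,
    fun f g => ⟨fun hg => hg.eq f.2 (hJ f), fun hg => hg ▸ hJ f⟩, ⟨fun f g h => ?_, fun B f => ?_⟩⟩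
  -- It suffices that every subsequence has a further subsequence converging to the same limit.
  · refine tendsto_of_subseq_tendsto fun ns hns => ?_
    exact TendstoL1.exists_subseq_john (f := f ∘ ns) (t := t ∘ f ∘ ns) (A := A ∘ f ∘ ns)
      (h.comp hns) (fun k => hA (f (ns k))) (hA g)
  · exact Subtype.ext ((hJ (LC.act B f)).eq (LC.act B f).2 ((hJ f).comp_affineEquiv f.2 B))
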